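/- Let $k \ge 2$ be an integer. For a positive integer $n$ let $r(n)$ be the number of pairs $(p,j)$, where $p$ is a prime and $j$ is a positive integer, such that $p + j^k = n$. Then there are constants $c_1(k) > 0$ and $c_2(k) > 0$, depending only on $k$, such that for every real number $x \ge 3$ $$\#\Bigl\{1 \le n \le x : r(n) \ge c_1(k)\,\frac{x^{1/k}}{\ln x}\Bigr\} \ge c_2(k)\,x .$$ In particular, for every real number $x \ge 3$, $$\#\{1 \le n \le x : \text{there are a prime } p \text{ and a positive integer } j \text{ such that } p + j^k = n\} \ge c_2(k)\,x .$$ Here $n$ runs over the integers. -/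

import Mathlib

/-- The number of pairs `(p, j)` of a prime `p` and a positive integer `j` with `p + j ^ k = n`
(for `k ≥ 1` there are only finitely many such pairs). -/
noncomputable def primePowReps (k n : ℕ) : ℕ :=
  {q : ℕ × ℕ | q.1.Prime ∧ 1 ≤ q.2 ∧ q.1 + q.2 ^ k = n}.ncard

/-! ### The Selberg upper bound sieve -/

section SelbergBound

open Finset BoundingSieve ArithmeticFunction
open scoped ArithmeticFunction.Moebius

/-! The proof is a second moment argument. Let `boundedReps` count the representations n = p + j^k
with p ≤ x/2 and j ≤ J = ⌊(x/2)^(1/k)⌋. By Chebyshev's lower bound for π, its sum over n ≤ x is at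
least a constant times xJ / log x. If its sum of squares is O(xJ² / log² x), then Cauchy–Schwarz
(`sq_le_card_filter_mul`) shows that it is of its average order on a positive proportion of n.

The sum of squares counts solutions of p + i^k = q + j^k. The diagonal gives at most xJ, which is
harmless because J ≥ log² x. For i < j, the pair q, q + h with h = j^k - i^k is a pair of primes,
and the Selberg sieve bounds the number of such pairs by O(x S(h) / log² M) plus a power of M
(`primePairs_le`), where M is a small power of x and S(h) is the sum of 1/e over squarefree e ≤ M
dividing h. The average of S over the differences j^k - i^k is bounded (`sum_truncSeries_le`): for
squarefree d and fixed i, the congruence j^k ≡ i^k has at most k^ω(d) solutions mod d, and ∑ k^ω(d)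
/ d² converges.

The sieve denominator G is not evaluated asymptotically. `sq_sum_squarefree_le` gives (∑ 1/u)² ≤ 2
S(h) G, with u squarefree up to M, by an injective rewriting of pairs (u, v), and ∑ 1/u ≥ (log M) /
2. -/

theorem sum_moebius_between {m l : ℕ} (hl : Squarefree l) (hm : m ∣ l) :
    ∑ d ∈ l.divisors, (if m ∣ d then (μ d : ℝ) else 0) = if l = m then (μ m : ℝ) else 0 := by
  obtain ⟨q, rfl⟩ := hm
  have hm0 : m ≠ 0 := by rintro rfl; simp at hl
  have hq0 : q ≠ 0 := by rintro rfl; simp at hl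
  have himg : (m * q).divisors.filter (m ∣ ·) = q.divisors.image (m * ·) := by
    ext d
    simp only [mem_filter, Nat.mem_divisors, mem_image]
    constructor
    · rintro ⟨⟨h1, -⟩, e, rfl⟩
      exact ⟨e, ⟨(Nat.mul_dvd_mul_iff_left (Nat.pos_of_ne_zero hm0)).1 h1, hq0⟩, rfl⟩
    · rintro ⟨e, ⟨h1, -⟩, rfl⟩
      exact ⟨⟨Nat.mul_dvd_mul_left m h1, mul_ne_zero hm0 hq0⟩, dvd_mul_right _ _⟩
  rw [← sum_filter, himg, sum_image fun a _ b _ h => Nat.eq_of_mul_eq_mul_left (Nat.pos_of_ne_zero hm0) h]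
  have hcop : Nat.Coprime m q := Nat.coprime_of_squarefree_mul hl
  have h1 : ∀ e ∈ q.divisors, ((μ (m * e) : ℤ) : ℝ) = μ m * μ e := by
    intro e he
    have : Nat.Coprime m e := hcop.coprime_dvd_right (Nat.dvd_of_mem_divisors he)
    rw [isMultiplicative_moebius.map_mul_of_coprime this]; push_cast; ring
  rw [sum_congr rfl h1, ← mul_sum]
  have h2 : (∑ e ∈ q.divisors, (μ e : ℝ)) = if q = 1 then 1 else 0 := by
    have h3 : (∑ e ∈ q.divisors, μ e) = if q = 1 then 1 else 0 := by
      rw [← coe_mul_zeta_apply, moebius_mul_coe_zeta, one_apply]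
    exact_mod_cast h3
  rw [h2]
  by_cases hq : q = 1
  · simp [hq]
  · have : m * q ≠ m := by
      intro h; exact hq (Nat.eq_of_mul_eq_mul_left (Nat.pos_of_ne_zero hm0) (by simpa using h))
    simp [hq, this]

/-- The divisors of the sifting modulus up to `R`. -/
def sieveDivisors (s : BoundingSieve) (R : ℕ) : Finset ℕ := s.prodPrimes.divisors.filter (· ≤ R)

/-- The denominator in the main term of the Selberg sieve. -/
noncomputable def selbergSum (s : BoundingSieve) (R : ℕ) : ℝ :=
  ∑ l ∈ sieveDivisors s R, s.selbergTerms l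

/-- The optimal weights of the Selberg sieve. -/
noncomputable def selbergWeight (s : BoundingSieve) (R d : ℕ) : ℝ :=
  μ d * (s.nu d)⁻¹ * (∑ l ∈ sieveDivisors s R, if d ∣ l then s.selbergTerms l else 0) /
    selbergSum s R

variable (s : BoundingSieve) {R : ℕ}

theorem dvd_of_mem_sieveDivisors {l : ℕ} (hl : l ∈ sieveDivisors s R) : l ∣ s.prodPrimes :=
  Nat.dvd_of_mem_divisors (mem_filter.1 hl).1

theorem selbergTerms_pos_of_mem {l : ℕ} (hl : l ∈ sieveDivisors s R) : 0 < s.selbergTerms l :=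
  selbergTerms_pos (dvd_of_mem_sieveDivisors s hl)

theorem selbergSum_pos (hR : 1 ≤ R) : 0 < selbergSum s R :=
  sum_pos (fun _ hl => selbergTerms_pos_of_mem s hl)
    ⟨1, by simp [sieveDivisors, hR, prodPrimes_ne_zero]⟩

theorem selbergWeight_one (hR : 1 ≤ R) : selbergWeight s R 1 = 1 := by
  have := (selbergSum_pos s hR).ne'
  simp only [selbergWeight, moebius_apply_one, s.nu_mult.map_one, one_dvd, if_true]
  rw [← selbergSum]; simp [this]

theorem selbergWeight_eq_zero {d : ℕ} (hd : d ∉ sieveDivisors s R) : selbergWeight s R d = 0 := by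
  rw [selbergWeight, sum_eq_zero, mul_zero, zero_div]
  intro l hl
  rw [if_neg]
  intro hdl
  refine hd (mem_filter.2 ⟨Nat.mem_divisors.2 ⟨hdl.trans (dvd_of_mem_sieveDivisors s hl),
    prodPrimes_ne_zero⟩, (Nat.le_of_dvd (Nat.pos_of_ne_zero ?_) hdl).trans (mem_filter.1 hl).2⟩)
  exact ne_zero_of_dvd_ne_zero prodPrimes_ne_zero (dvd_of_mem_sieveDivisors s hl)

/-- The inner sum is part of `selbergSum`, so only the factor 1/ν(d) ≤ d ≤ R is left. The classical
bound 1 is not needed, since the level of the sieve will be a tiny power of x. -/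
theorem abs_selbergWeight_le (hR : 1 ≤ R) (hnu : ∀ d, d ∣ s.prodPrimes → (s.nu d)⁻¹ ≤ d) (d : ℕ) :
    |selbergWeight s R d| ≤ R := by
  by_cases hd : d ∈ sieveDivisors s R
  · have hG := selbergSum_pos s hR
    have hdP := dvd_of_mem_sieveDivisors s hd
    have hmu : |(μ d : ℝ)| ≤ 1 := by exact_mod_cast abs_moebius_le_one
    have hnu0 := nu_pos_of_dvd_prodPrimes hdP
    have hS0 : 0 ≤ ∑ l ∈ sieveDivisors s R, if d ∣ l then s.selbergTerms l else 0 :=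
      sum_nonneg fun l hl => by
        split_ifs
        exacts [(selbergTerms_pos_of_mem s hl).le, le_rfl]
    have hS : (∑ l ∈ sieveDivisors s R, if d ∣ l then s.selbergTerms l else 0) ≤ selbergSum s R :=
      sum_le_sum fun l hl => by
        split_ifs
        exacts [le_rfl, (selbergTerms_pos_of_mem s hl).le]
    rw [selbergWeight, abs_div, abs_mul, abs_mul, abs_of_pos hG, abs_of_nonneg hS0,
      abs_of_pos (inv_pos.2 hnu0), div_le_iff₀ hG]
    have hdR : (d : ℝ) ≤ R := by exact_mod_cast (mem_filter.1 hd).2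
    have h1 : |(μ d : ℝ)| * (s.nu d)⁻¹ ≤ 1 * R :=
      mul_le_mul hmu ((hnu d hdP).trans hdR) (inv_pos.2 hnu0).le zero_le_one
    rw [one_mul] at h1
    exact mul_le_mul h1 hS hS0 (Nat.cast_nonneg _)
  · rw [selbergWeight_eq_zero s hd, abs_zero]; exact Nat.cast_nonneg _

/-- Dual Möbius inversion: after exchanging sums, the sum of μ(d) over m ∣ d ∣ l vanishes unless l =
m. These sums are the variables that diagonalise the quadratic form of the sieve. -/
theorem sum_nu_mul_selbergWeight {m : ℕ} (hm : m ∣ s.prodPrimes) :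
    (∑ d ∈ s.prodPrimes.divisors, if m ∣ d then s.nu d * selbergWeight s R d else 0) =
      if m ∈ sieveDivisors s R then μ m * s.selbergTerms m / selbergSum s R else 0 := by
  have h1 : ∀ d ∈ s.prodPrimes.divisors,
      (if m ∣ d then s.nu d * selbergWeight s R d else 0) =
      ∑ l ∈ sieveDivisors s R, (s.selbergTerms l / selbergSum s R) *
        (if d ∣ l then (if m ∣ d then (μ d : ℝ) else 0) else 0) := by
    intro d hd
    have := (nu_pos_of_dvd_prodPrimes (Nat.dvd_of_mem_divisors hd)).ne'
    split_ifs with hmd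
    · rw [selbergWeight, mul_sum, sum_div, mul_sum]
      refine sum_congr rfl fun l _ => ?_
      split_ifs
      · field_simp
      · simp
    · simp
  rw [sum_congr rfl h1, sum_comm]
  have h2 : ∀ l ∈ sieveDivisors s R,
      ∑ d ∈ s.prodPrimes.divisors, (s.selbergTerms l / selbergSum s R) *
        (if d ∣ l then (if m ∣ d then (μ d : ℝ) else 0) else 0) =
      if l = m then μ m * s.selbergTerms m / selbergSum s R else 0 := by
    intro l hl
    have hlP := dvd_of_mem_sieveDivisors s hl
    rw [← mul_sum, ← sum_filter, Nat.divisors_filter_dvd_of_dvd prodPrimes_ne_zero hlP]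
    by_cases hml : m ∣ l
    · rw [sum_moebius_between (squarefree_of_dvd_prodPrimes hlP) hml]
      split_ifs with h
      · subst h; ring
      · simp
    · rw [sum_eq_zero, mul_zero, if_neg (by rintro rfl; exact hml dvd_rfl)]
      intro d hd
      rw [if_neg fun h => hml (h.trans (Nat.dvd_of_mem_divisors hd))]
  rw [sum_congr rfl h2, sum_ite_eq']

/-- In diagonal form each l ≤ R contributes g(l) / G², where g denotes `selbergTerms` and G their
sum, so the total is G / G². -/
theorem mainSum_selbergWeight (hR : 1 ≤ R) :
    s.mainSum (lambdaSquared (selbergWeight s R)) = (selbergSum s R)⁻¹ := by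
  have hG := (selbergSum_pos s hR).ne'
  rw [mainSum_lambdaSquared_eq_sum_mul_sum_sq]
  have h1 : ∀ l ∈ s.prodPrimes.divisors, (s.selbergTerms l)⁻¹ *
      (∑ d ∈ s.prodPrimes.divisors, if l ∣ d then s.nu d * selbergWeight s R d else 0) ^ 2 =
      if l ≤ R then s.selbergTerms l / selbergSum s R ^ 2 else 0 := by
    intro l hl
    have hlP := Nat.dvd_of_mem_divisors hl
    have hg := (selbergTerms_pos hlP).ne'
    rw [sum_nu_mul_selbergWeight s hlP]
    have hmu : (μ l : ℝ) ^ 2 = 1 := by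
      have := moebius_sq_eq_one_of_squarefree (squarefree_of_dvd_prodPrimes hlP)
      exact_mod_cast this
    by_cases hlR : l ≤ R
    · have hm : l ∈ sieveDivisors s R := mem_filter.2 ⟨hl, hlR⟩
      rw [if_pos hm, if_pos hlR, div_pow, mul_pow, hmu]
      field_simp
    · have hm : l ∉ sieveDivisors s R := fun h => hlR (mem_filter.1 h).2
      rw [if_neg hm, if_neg hlR]; simp
  rw [sum_congr rfl h1, ← sum_filter, ← sum_div]
  change selbergSum s R / selbergSum s R ^ 2 = _
  field_simp

theorem sum_abs_selbergWeight_le (hR : 1 ≤ R)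
    (hnu : ∀ d, d ∣ s.prodPrimes → (s.nu d)⁻¹ ≤ d) (d : ℕ) :
    ∑ e ∈ d.divisors, |selbergWeight s R e| ≤ (R : ℝ) ^ 2 := by
  calc ∑ e ∈ d.divisors, |selbergWeight s R e|
      = ∑ e ∈ d.divisors.filter (· ∈ sieveDivisors s R), |selbergWeight s R e| := by
        rw [sum_filter]
        refine sum_congr rfl fun e _ => ?_
        split_ifs with h
        · rfl
        · rw [selbergWeight_eq_zero s h, abs_zero]
    _ ≤ ∑ e ∈ d.divisors.filter (· ∈ sieveDivisors s R), (R : ℝ) :=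
        sum_le_sum fun e _ => abs_selbergWeight_le s hR hnu e
    _ ≤ (R : ℝ) ^ 2 := by
        rw [sum_const, nsmul_eq_mul, sq]
        refine mul_le_mul_of_nonneg_right ?_ (Nat.cast_nonneg _)
        have : d.divisors.filter (· ∈ sieveDivisors s R) ⊆ Icc 1 R := by
          intro e he
          rw [mem_filter] at he
          exact mem_Icc.2 ⟨Nat.pos_of_mem_divisors he.1, (mem_filter.1 he.2).2⟩
        have := card_le_card this
        rw [Nat.card_Icc, Nat.add_sub_cancel] at this
        exact_mod_cast this

theorem abs_lambdaSquared_selbergWeight_le (hR : 1 ≤ R)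
    (hnu : ∀ d, d ∣ s.prodPrimes → (s.nu d)⁻¹ ≤ d) (d : ℕ) :
    |lambdaSquared (selbergWeight s R) d| ≤ (R : ℝ) ^ 4 := by
  calc |lambdaSquared (selbergWeight s R) d|
      ≤ ∑ d1 ∈ d.divisors, ∑ d2 ∈ d.divisors, |selbergWeight s R d1| * |selbergWeight s R d2| := by
        refine (abs_sum_le_sum_abs _ _).trans (sum_le_sum fun d1 _ =>
          (abs_sum_le_sum_abs _ _).trans (sum_le_sum fun d2 _ => ?_))
        split_ifs
        · rw [abs_mul]
        · rw [abs_zero]; positivity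
    _ = (∑ e ∈ d.divisors, |selbergWeight s R e|) ^ 2 := by rw [sq, sum_mul_sum]
    _ ≤ ((R : ℝ) ^ 2) ^ 2 := by
        gcongr
        exact sum_abs_selbergWeight_le s hR hnu d
    _ = _ := by ring

theorem lambdaSquared_selbergWeight_eq_zero {d : ℕ} (hd : R ^ 2 < d) :
    lambdaSquared (selbergWeight s R) d = 0 := by
  refine sum_eq_zero fun d1 _ => sum_eq_zero fun d2 _ => ?_
  split_ifs with h
  · by_cases h1 : d1 ∈ sieveDivisors s R
    · by_cases h2 : d2 ∈ sieveDivisors s R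
      · exfalso
        have : d ≤ R ^ 2 := by
          rw [h, sq]
          refine (Nat.le_of_dvd ?_ (Nat.lcm_dvd_mul d1 d2)).trans
            (Nat.mul_le_mul (mem_filter.1 h1).2 (mem_filter.1 h2).2)
          exact Nat.mul_pos (Nat.pos_of_mem_divisors (mem_filter.1 h1).1)
            (Nat.pos_of_mem_divisors (mem_filter.1 h2).1)
        omega
      · rw [selbergWeight_eq_zero s h2, mul_zero]
    · rw [selbergWeight_eq_zero s h1, zero_mul]
  · rfl

/-- The Selberg upper bound sieve, with a crude remainder term. -/
theorem siftedSum_le_selberg (hR : 1 ≤ R) (hnu : ∀ d, d ∣ s.prodPrimes → (s.nu d)⁻¹ ≤ d)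
    {E : ℝ} (hE : ∀ d, d ∣ s.prodPrimes → d ≤ R ^ 2 → |s.rem d| ≤ E) :
    s.siftedSum ≤ s.totalMass / selbergSum s R + (R : ℝ) ^ 6 * E := by
  refine (siftedSum_le_mainSum_errSum_of_upperMoebius _
    (upperMoebius_lambdaSquared _ (selbergWeight_one s hR))).trans ?_
  rw [mainSum_selbergWeight s hR, div_eq_mul_inv]
  gcongr
  have hE0 : 0 ≤ E := (abs_nonneg _).trans (hE 1 (one_dvd _) (Nat.one_le_pow _ _ hR))
  -- Only d ≤ R² matter, at most R² of them, each with weight at most R⁴.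
  calc s.errSum (lambdaSquared (selbergWeight s R))
      = ∑ d ∈ s.prodPrimes.divisors.filter (· ≤ R ^ 2),
          |lambdaSquared (selbergWeight s R) d| * |s.rem d| := by
        rw [errSum, sum_filter]
        refine sum_congr rfl fun d _ => ?_
        split_ifs with h
        · rfl
        · rw [lambdaSquared_selbergWeight_eq_zero s (not_le.1 h), abs_zero, zero_mul]
    _ ≤ ∑ d ∈ s.prodPrimes.divisors.filter (· ≤ R ^ 2), (R : ℝ) ^ 4 * E := by
        refine sum_le_sum fun d hd => ?_
        rw [mem_filter] at hd
        exact mul_le_mul (abs_lambdaSquared_selbergWeight_le s hR hnu d)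
          (hE d (Nat.dvd_of_mem_divisors hd.1) hd.2) (abs_nonneg _) (by positivity)
    _ ≤ (R : ℝ) ^ 2 * ((R : ℝ) ^ 4 * E) := by
        rw [sum_const, nsmul_eq_mul]
        refine mul_le_mul_of_nonneg_right ?_ (by positivity)
        have : s.prodPrimes.divisors.filter (· ≤ R ^ 2) ⊆ Icc 1 (R ^ 2) := by
          intro e he
          rw [mem_filter] at he
          exact mem_Icc.2 ⟨Nat.pos_of_mem_divisors he.1, he.2⟩
        have := card_le_card this
        rw [Nat.card_Icc, Nat.add_sub_cancel] at this
        exact_mod_cast this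
    _ = _ := by ring

end SelbergBound

/-! ### Roots of integer polynomials modulo squarefree numbers -/

section RootCount

open Finset Polynomial

/-- The number of roots of an integer polynomial modulo `m`. -/
noncomputable def rootCount (f : ℤ[X]) (m : ℕ) : ℕ :=
  Nat.card {a : ZMod m // f.eval₂ (Int.castRingHom (ZMod m)) a = 0}

theorem rootCount_one (f : ℤ[X]) : rootCount f 1 = 1 := by
  have : Unique {a : ZMod 1 // f.eval₂ (Int.castRingHom (ZMod 1)) a = 0} :=
    ⟨⟨⟨0, Subsingleton.elim _ _⟩⟩, fun a => Subtype.ext (Subsingleton.elim _ _)⟩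
  exact Nat.card_unique

/-- Evaluation of f commutes with the Chinese remainder isomorphism, so a root mod mn is a pair of
roots. -/
theorem rootCount_mul (f : ℤ[X]) {m n : ℕ} (h : m.Coprime n) :
    rootCount f (m * n) = rootCount f m * rootCount f n := by
  rw [rootCount, rootCount, rootCount, ← Nat.card_prod]
  let e := ZMod.chineseRemainder h
  have key : ∀ a : ZMod (m * n), f.eval₂ (Int.castRingHom _) a = 0 ↔
      f.eval₂ (Int.castRingHom _) (e a).1 = 0 ∧ f.eval₂ (Int.castRingHom _) (e a).2 = 0 := by
    intro a
    have h1 := f.hom_eval₂ (Int.castRingHom _) ((RingHom.fst (ZMod m) (ZMod n)).comp e.toRingHom) a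
    have h2 := f.hom_eval₂ (Int.castRingHom _) ((RingHom.snd (ZMod m) (ZMod n)).comp e.toRingHom) a
    rw [RingHom.eq_intCast' (RingHom.comp _ (Int.castRingHom _))] at h1 h2
    change (e (f.eval₂ (Int.castRingHom _) a)).1 = f.eval₂ (Int.castRingHom _) (e a).1 at h1
    change (e (f.eval₂ (Int.castRingHom _) a)).2 = f.eval₂ (Int.castRingHom _) (e a).2 at h2
    rw [← h1, ← h2, ← map_eq_zero_iff e e.injective, Prod.ext_iff]
    rfl
  exact Nat.card_congr ((e.toEquiv.subtypeEquiv key).trans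
    (Equiv.subtypeProdEquivProd (p := fun a : ZMod m => f.eval₂ (Int.castRingHom _) a = 0)
      (q := fun b : ZMod n => f.eval₂ (Int.castRingHom _) b = 0)))

theorem rootCount_eq_prod (f : ℤ[X]) {m : ℕ} (hm : Squarefree m) :
    rootCount f m = ∏ p ∈ m.primeFactors, rootCount f p := by
  let F : ArithmeticFunction ℕ := ⟨fun n => if n = 0 then 0 else rootCount f n, if_pos rfl⟩
  have hF : ∀ n, n ≠ 0 → F n = rootCount f n := fun n hn => if_neg hn
  have hmul : F.IsMultiplicative := by
    rw [ArithmeticFunction.IsMultiplicative.iff_ne_zero]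
    refine ⟨(hF 1 one_ne_zero).trans (rootCount_one f), fun {a b} ha hb hab => ?_⟩
    rw [hF _ (mul_ne_zero ha hb), hF _ ha, hF _ hb, rootCount_mul f hab]
  have h := hmul.map_prod_of_subset_primeFactors m m.primeFactors subset_rfl
  rw [Nat.prod_primeFactors_of_squarefree hm, hF _ hm.ne_zero] at h
  rw [h]
  exact prod_congr rfl fun p hp => hF p (Nat.prime_of_mem_primeFactors hp).ne_zero

theorem rootCount_le_self (f : ℤ[X]) {m : ℕ} (hm : 0 < m) : rootCount f m ≤ m := by
  have : NeZero m := ⟨hm.ne'⟩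
  calc rootCount f m ≤ Nat.card (ZMod m) := Nat.card_le_card_of_injective _ Subtype.val_injective
    _ = m := Nat.card_zmod m

theorem abs_card_modEq_sub_le (N : ℕ) {m : ℕ} (hm : 0 < m) (v : ℕ) :
    |(#{n ∈ Ioc 0 N | n ≡ v [MOD m]} : ℝ) - N / m| ≤ 1 := by
  have h := Nat.Ioc_filter_modEq_card 0 N hm v
  have hmR : (0 : ℚ) < m := by exact_mod_cast hm
  have hle : ((0 : ℕ) - v : ℚ) / m ≤ ((N : ℕ) - v : ℚ) / m := by
    gcongr; exact Nat.zero_le _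
  rw [max_eq_left (sub_nonneg.2 (Int.floor_le_floor hle))] at h
  have h' : ((#{n ∈ Ioc 0 N | n ≡ v [MOD m]} : ℤ) : ℚ) =
    (⌊((N : ℕ) - v : ℚ) / m⌋ : ℚ) - ⌊((0 : ℕ) - v : ℚ) / m⌋ := by rw [h]; push_cast; rfl
  have a1 := Int.floor_le (((N : ℕ) - v : ℚ) / m)
  have a2 := Int.lt_floor_add_one (((N : ℕ) - v : ℚ) / m)
  have a3 := Int.floor_le (((0 : ℕ) - v : ℚ) / m)
  have a4 := Int.lt_floor_add_one (((0 : ℕ) - v : ℚ) / m)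
  have e1 : ((N : ℕ) - v : ℚ) / m - ((0 : ℕ) - v : ℚ) / m = N / m := by push_cast; ring
  have key : |((#{n ∈ Ioc 0 N | n ≡ v [MOD m]} : ℕ) : ℚ) - N / m| ≤ 1 := by
    rw [abs_le]
    push_cast at h' ⊢
    constructor <;> linarith
  have key' : ((|((#{n ∈ Ioc 0 N | n ≡ v [MOD m]} : ℕ) : ℚ) - N / m| : ℚ) : ℝ) ≤ (1 : ℚ) :=
    Rat.cast_le.2 key
  push_cast at key'
  exact key'

/-- The condition selects `rootCount f m` residue classes, and each is counted with error at most 1.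
-/
theorem abs_card_dvd_eval_sub_le (f : ℤ[X]) (N : ℕ) {m : ℕ} (hm : 0 < m) :
    |(#((Ioc 0 N).filter fun n : ℕ => (m : ℤ) ∣ f.eval (n : ℤ)) : ℝ) - rootCount f m / m * N| ≤ rootCount f m := by
  classical
  have : NeZero m := ⟨hm.ne'⟩
  let A : Finset (ZMod m) := {a | f.eval₂ (Int.castRingHom (ZMod m)) a = 0}
  have hA : rootCount f m = #A := by
    rw [rootCount, Nat.card_eq_fintype_card, Fintype.card_subtype]
  have hmem : ∀ n : ℕ, (m : ℤ) ∣ f.eval (n : ℤ) ↔ (n : ZMod m) ∈ A := by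
    intro n
    have := f.hom_eval₂ (RingHom.id ℤ) (Int.castRingHom (ZMod m)) (n : ℤ)
    rw [RingHom.comp_id, ← Polynomial.eval₂_id] at *
    rw [← ZMod.intCast_zmod_eq_zero_iff_dvd, mem_filter]
    simp only [Finset.mem_univ, true_and]
    rw [eq_intCast, eq_intCast, Int.cast_natCast] at this
    rw [this]
  have hcard : #((Ioc 0 N).filter fun n : ℕ => (m : ℤ) ∣ f.eval (n : ℤ)) =
      ∑ a ∈ A, #{n ∈ Ioc 0 N | n ≡ a.val [MOD m]} := by
    rw [card_eq_sum_card_fiberwise (f := fun n : ℕ => (n : ZMod m)) (t := A)]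
    · refine sum_congr rfl fun a ha => ?_
      congr 1
      ext n
      simp only [mem_filter, hmem]
      rw [← ZMod.natCast_eq_natCast_iff, ZMod.natCast_zmod_val]
      constructor
      · rintro ⟨⟨h1, -⟩, h2⟩; exact ⟨h1, h2⟩
      · rintro ⟨h1, h2⟩; exact ⟨⟨h1, h2 ▸ ha⟩, h2⟩
    · intro n hn
      exact (hmem n).1 (mem_filter.1 hn).2
  rw [hcard, hA]
  have : ((∑ a ∈ A, #{n ∈ Ioc 0 N | n ≡ a.val [MOD m]} : ℕ) : ℝ) - #A / m * N =
      ∑ a ∈ A, ((#{n ∈ Ioc 0 N | n ≡ a.val [MOD m]} : ℝ) - N / m) := by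
    rw [sum_sub_distrib, sum_const, nsmul_eq_mul]; push_cast; ring
  rw [this]
  refine (abs_sum_le_sum_abs _ _).trans ?_
  calc _ ≤ ∑ a ∈ A, (1 : ℝ) := sum_le_sum fun a _ => abs_card_modEq_sub_le N hm a.val
    _ = _ := by simp

theorem rootCount_X_pow_sub_C_le {k : ℕ} (hk : 0 < k) (c : ℤ) {p : ℕ} (hp : p.Prime) :
    rootCount (X ^ k - C c) p ≤ k := by
  have : Fact p.Prime := ⟨hp⟩
  classical
  have h : ∀ a : ZMod p, (X ^ k - C c : ℤ[X]).eval₂ (Int.castRingHom (ZMod p)) a = 0 ↔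
      a ∈ (nthRoots k (c : ZMod p)).toFinset := by
    intro a
    rw [Multiset.mem_toFinset, mem_nthRoots hk]
    rw [eval₂_sub, eval₂_X_pow, eval₂_C, sub_eq_zero, eq_intCast]
  rw [rootCount, Nat.card_congr (Equiv.subtypeEquivRight h), Nat.card_eq_fintype_card,
    Fintype.card_coe]
  exact (Multiset.toFinset_card_le _).trans (card_nthRoots _ _)

theorem rootCount_X_mul_X_add_C {h p : ℕ} (hp : p.Prime) :
    rootCount (X * (X + C (h : ℤ))) p = if p ∣ h then 1 else 2 := by
  have : Fact p.Prime := ⟨hp⟩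
  classical
  have h1 : ∀ a : ZMod p, (X * (X + C (h : ℤ)) : ℤ[X]).eval₂ (Int.castRingHom (ZMod p)) a = 0 ↔
      a ∈ ({0, -(h : ZMod p)} : Finset (ZMod p)) := by
    intro a
    simp [eval₂_mul, eval₂_add, eq_neg_iff_add_eq_zero]
  rw [rootCount, Nat.card_congr (Equiv.subtypeEquivRight h1), Nat.card_eq_fintype_card,
    Fintype.card_coe]
  split_ifs with hd
  · rw [(ZMod.natCast_eq_zero_iff h p).2 hd]; simp
  · rw [card_pair]
    intro h0
    exact hd ((ZMod.natCast_eq_zero_iff h p).1 (neg_eq_zero.1 h0.symm))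

end RootCount

/-! ### Prime pairs with a given difference -/

section PrimePairs

open Finset Polynomial

theorem sum_le_sum_of_injOn {ι κ : Type*} {s : Finset ι} {t : Finset κ} {f : ι → ℝ} {g : κ → ℝ}
    (e : ι → κ) (hg : ∀ y ∈ t, 0 ≤ g y) (hmaps : ∀ x ∈ s, e x ∈ t)
    (hinj : ∀ x ∈ s, ∀ y ∈ s, e x = e y → x = y) (hfg : ∀ x ∈ s, f x ≤ g (e x)) :
    ∑ x ∈ s, f x ≤ ∑ y ∈ t, g y := by
  classical
  calc ∑ x ∈ s, f x ≤ ∑ x ∈ s, g (e x) := sum_le_sum hfg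
    _ = ∑ y ∈ s.image e, g y := (sum_image hinj).symm
    _ ≤ ∑ y ∈ t, g y := sum_le_sum_of_subset_of_nonneg
        (fun y hy => by obtain ⟨x, hx, rfl⟩ := mem_image.1 hy; exact hmaps x hx)
        (fun y hy _ => hg y hy)

/-- The polynomial `n (n + h)` whose values are sifted. -/
noncomputable def pairPoly (h : ℕ) : ℤ[X] := X * (X + C (h : ℤ))

theorem eval_pairPoly (h n : ℕ) : (pairPoly h).eval (n : ℤ) = ((n * (n + h) : ℕ) : ℤ) := by
  simp [pairPoly]

theorem rootCount_pairPoly_pos (h : ℕ) {d : ℕ} (hd : Squarefree d) :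
    0 < rootCount (pairPoly h) d := by
  rw [rootCount_eq_prod _ hd]
  refine prod_pos fun p hp => ?_
  rw [pairPoly, rootCount_X_mul_X_add_C (Nat.prime_of_mem_primeFactors hp)]
  split_ifs <;> norm_num

/-- Both sides are multiplicative, and at a prime p both equal 1 if p ∣ h and 2 otherwise. -/
theorem card_coprime_divisors_le_rootCount (h : ℕ) {l : ℕ} (hl : Squarefree l) :
    #(l.divisors.filter (Nat.Coprime · h)) ≤ rootCount (pairPoly h) l := by
  let F : ArithmeticFunction ℕ := ⟨fun n => if n = 0 then 0 else if n.Coprime h then 1 else 0,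
    if_pos rfl⟩
  have hF : ∀ n, n ≠ 0 → F n = if n.Coprime h then 1 else 0 := fun n hn => if_neg hn
  have hmul : F.IsMultiplicative := by
    rw [ArithmeticFunction.IsMultiplicative.iff_ne_zero]
    refine ⟨by rw [hF 1 one_ne_zero, if_pos (Nat.coprime_one_left h)], fun {a b} ha hb hab => ?_⟩
    rw [hF _ (mul_ne_zero ha hb), hF _ ha, hF _ hb, if_congr Nat.coprime_mul_iff_left rfl rfl]
    split_ifs <;> simp_all
  have h1 := hmul.prodPrimeFactors_one_add_of_squarefree hl
  rw [card_filter, rootCount_eq_prod _ hl]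
  rw [sum_congr rfl fun d hd => (hF d (Nat.pos_of_mem_divisors hd).ne').symm, ← h1]
  refine prod_le_prod' fun p hp => ?_
  have hp' := Nat.prime_of_mem_primeFactors hp
  rw [hF p hp'.ne_zero, pairPoly, rootCount_X_mul_X_add_C hp',
    if_congr hp'.coprime_iff_not_dvd rfl rfl]
  split_ifs <;> simp_all

/-- The sieve problem for the values `n (n + h)` with `0 < n ≤ N`, by the primes up to `R`. -/
noncomputable def pairSieve (N R : ℕ) {h : ℕ} (hh : Even h) : BoundingSieve where
  support := (Ioc 0 N).image fun n => n * (n + h)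
  prodPrimes := primorial R
  prodPrimes_squarefree := squarefree_primorial R
  weights m := #{n ∈ Ioc 0 N | n * (n + h) = m}
  weights_nonneg _ := Nat.cast_nonneg _
  totalMass := N
  nu := ArithmeticFunction.prodPrimeFactors fun p => (rootCount (pairPoly h) p : ℝ) / p
  nu_mult := ArithmeticFunction.IsMultiplicative.prodPrimeFactors _
  nu_pos_of_prime p hp _ := by
    rw [ArithmeticFunction.prodPrimeFactors_apply hp.ne_zero, hp.primeFactors, prod_singleton]
    have := rootCount_pairPoly_pos h hp.squarefree
    have := hp.pos
    positivity
  nu_lt_one_of_prime p hp _ := by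
    rw [ArithmeticFunction.prodPrimeFactors_apply hp.ne_zero, hp.primeFactors, prod_singleton,
      pairPoly, rootCount_X_mul_X_add_C hp, div_lt_one (by exact_mod_cast hp.pos)]
    split_ifs with hd
    · exact_mod_cast hp.one_lt
    -- Evenness of h enters here: for odd h both classes mod 2 would be removed, and the density at
    -- 2 would be 1.
    · have h2 : p ≠ 2 := by rintro rfl; exact hd hh.two_dvd
      have := hp.two_le
      exact_mod_cast (show 2 < p by omega)

variable {N R h : ℕ} (hh : Even h)

theorem nu_pairSieve {d : ℕ} (hd : Squarefree d) :
    (pairSieve N R hh).nu d = rootCount (pairPoly h) d / d := by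
  change ArithmeticFunction.prodPrimeFactors (fun p => (rootCount (pairPoly h) p : ℝ) / p) d = _
  rw [ArithmeticFunction.prodPrimeFactors_apply hd.ne_zero, prod_div_distrib,
    rootCount_eq_prod _ hd, ← Nat.cast_prod, ← Nat.cast_prod,
    Nat.prod_primeFactors_of_squarefree hd]

theorem sum_weights_pairSieve (P : ℕ → Prop) [DecidablePred P] :
    (∑ m ∈ (pairSieve N R hh).support, if P m then (pairSieve N R hh).weights m else 0) =
      #{n ∈ Ioc 0 N | P (n * (n + h))} := by
  have := sum_comp (s := Ioc 0 N) (fun m : ℕ => if P m then (1 : ℝ) else 0)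
    (fun n => n * (n + h))
  rw [card_filter, Nat.cast_sum]
  simp only [Nat.cast_ite, Nat.cast_one, Nat.cast_zero]
  rw [this]
  refine sum_congr rfl fun m _ => ?_
  simp [pairSieve]

theorem abs_rem_pairSieve_le {d : ℕ} (hd : Squarefree d) :
    |(pairSieve N R hh).rem d| ≤ d := by
  have hd0 := Nat.pos_of_ne_zero hd.ne_zero
  have h1 := abs_card_dvd_eval_sub_le (pairPoly h) N hd0
  rw [BoundingSieve.rem, BoundingSieve.multSum, sum_weights_pairSieve hh (d ∣ ·), nu_pairSieve hh hd]
  simp only [eval_pairPoly, Int.natCast_dvd_natCast] at h1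
  exact h1.trans (by exact_mod_cast rootCount_le_self _ hd0)

/-- The number of prime pairs `n, n + h` with `n ≤ N`. -/
def primePairs (N h : ℕ) : ℕ := #{n ∈ Ioc 0 N | n.Prime ∧ (n + h).Prime}

theorem primePairs_le_selberg (hR : 1 ≤ R) :
    (primePairs N h : ℝ) ≤ N / selbergSum (pairSieve N R hh) R + (R : ℝ) ^ 8 + R := by
  have hS := siftedSum_le_selberg (pairSieve N R hh) hR (E := (R : ℝ) ^ 2)
    (fun d hd => by
      have hsq := BoundingSieve.squarefree_of_dvd_prodPrimes hd
      have hd0 : (0 : ℝ) < d := by exact_mod_cast Nat.pos_of_ne_zero hsq.ne_zero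
      have h1 : (1 : ℝ) ≤ rootCount (pairPoly h) d := by
        exact_mod_cast rootCount_pairPoly_pos h hsq
      rw [nu_pairSieve hh hsq, inv_div, div_le_iff₀ (by linarith)]
      nlinarith)
    (fun d hd hdR => (abs_rem_pairSieve_le hh (BoundingSieve.squarefree_of_dvd_prodPrimes hd)).trans
      (by exact_mod_cast hdR))
  -- A pair with n > R survives the sieve, while at most R pairs have n ≤ R.
  have hsift : (primePairs N h : ℝ) ≤ (pairSieve N R hh).siftedSum + R := by
    rw [BoundingSieve.siftedSum, sum_weights_pairSieve hh (Nat.Coprime (pairSieve N R hh).prodPrimes)]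
    have hsub : (Ioc 0 N).filter (fun n => n.Prime ∧ (n + h).Prime) ⊆
        (Ioc 0 N).filter (fun n => Nat.Coprime (pairSieve N R hh).prodPrimes (n * (n + h))) ∪
          Icc 1 R := by
      intro n hn
      rw [mem_filter] at hn
      obtain ⟨hnN, hn1, hn2⟩ := hn
      rw [mem_union, mem_filter, mem_Icc]
      by_cases hnR : n ≤ R
      · exact Or.inr ⟨hn1.one_le, hnR⟩
      · refine Or.inl ⟨hnN, ?_⟩
        change Nat.Coprime (primorial R) _
        rw [Nat.coprime_mul_iff_right, Nat.coprime_comm, hn1.coprime_iff_not_dvd,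
          Nat.coprime_comm, hn2.coprime_iff_not_dvd, hn1.dvd_primorial_iff, hn2.dvd_primorial_iff]
        omega
    have := (card_le_card hsub).trans (card_union_le _ _)
    rw [Nat.card_Icc, Nat.add_sub_cancel] at this
    exact_mod_cast this
  have h8 : (R : ℝ) ^ 6 * (R : ℝ) ^ 2 = (R : ℝ) ^ 8 := by ring
  have hmass : (pairSieve N R hh).totalMass = N := rfl
  rw [hmass, h8] at hS
  linarith

/-- Squarefree numbers up to `M`. -/
def squarefreeUpTo (M : ℕ) : Finset ℕ := (Icc 1 M).filter Squarefree

/-- The truncated singular series `∑ 1 / e` over the squarefree divisors `e ≤ M` of `h`. -/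
noncomputable def truncSeries (M h : ℕ) : ℝ := ∑ e ∈ squarefreeUpTo M with e ∣ h, (1 : ℝ) / e

theorem truncSeries_nonneg (M h : ℕ) : 0 ≤ truncSeries M h :=
  sum_nonneg fun _ _ => by positivity

theorem one_le_truncSeries {M : ℕ} (hM : 1 ≤ M) (h : ℕ) : 1 ≤ truncSeries M h := by
  have : (1 : ℕ) ∈ (squarefreeUpTo M).filter (· ∣ h) := by simp [squarefreeUpTo, hM]
  calc (1 : ℝ) = 1 / (1 : ℕ) := by simp
    _ ≤ _ := single_le_sum (f := fun e : ℕ => (1 : ℝ) / e) (fun _ _ => by positivity) this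

theorem sum_inv_sq_le_two (M : ℕ) : ∑ d ∈ Icc 1 M, (1 : ℝ) / d ^ 2 ≤ 2 := by
  have : ∀ M : ℕ, ∑ d ∈ Icc 1 (M + 1), (1 : ℝ) / d ^ 2 ≤ 2 - 1 / ((M : ℝ) + 1) := by
    intro M
    induction M with
    | zero => norm_num
    | succ n ih =>
      rw [sum_Icc_succ_top (by omega)]
      have hn : (0 : ℝ) ≤ n := Nat.cast_nonneg n
      have : (1 : ℝ) / ((n : ℝ) + 1 + 1) ^ 2 ≤ 1 / ((n : ℝ) + 1) - 1 / ((n : ℝ) + 1 + 1) := by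
        rw [div_sub_div _ _ (by positivity) (by positivity), div_le_div_iff₀ (by positivity) (by positivity)]
        nlinarith
      push_cast
      linarith
  rcases M with _ | M
  · simp
  · have h1 := this M
    have : (0 : ℝ) ≤ 1 / ((M : ℝ) + 1) := by positivity
    linarith

/-- Writing n = b²a with a squarefree, the harmonic sum up to M is at most (∑ 1/b²)(∑ 1/a), and the
first factor is at most 2. -/
theorem log_le_two_mul_sum_squarefree (M : ℕ) :
    Real.log M ≤ 2 * ∑ u ∈ squarefreeUpTo M, (1 : ℝ) / u := by
  have h1 : Real.log M ≤ ∑ n ∈ Icc 1 M, (1 : ℝ) / n := by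
    rcases Nat.eq_zero_or_pos M with rfl | hM
    · simp
    have h2 := log_add_one_le_harmonic M
    have h3 : Real.log M ≤ Real.log ((M + 1 : ℕ) : ℝ) := by
      apply Real.log_le_log (by exact_mod_cast hM); push_cast; linarith
    rw [harmonic_eq_sum_Icc] at h2
    push_cast at h2 h3
    simp only [one_div]
    linarith
  have hK : 0 ≤ ∑ u ∈ squarefreeUpTo M, (1 : ℝ) / u := sum_nonneg fun _ _ => by positivity
  refine h1.trans (le_trans ?_ (mul_le_mul_of_nonneg_right (sum_inv_sq_le_two M) hK))
  rw [sum_mul_sum, ← sum_product']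
  choose! a b hab hsq using Nat.sq_mul_squarefree
  have hpos : ∀ n, 1 ≤ n → 0 < a n ∧ 0 < b n := by
    intro n hn
    have := hab n
    constructor
    · exact Nat.pos_of_ne_zero (hsq n).ne_zero
    · rcases Nat.eq_zero_or_pos (b n) with h0 | h0
      · rw [h0] at this; simp at this; omega
      · exact h0
  refine sum_le_sum_of_injOn (fun n => (b n, a n)) (fun _ _ => by positivity) ?_ ?_ ?_
  · intro n hn
    rw [mem_Icc] at hn
    obtain ⟨ha, hb⟩ := hpos n hn.1
    have h2 := hab n
    have hb1 : b n ≤ b n ^ 2 := Nat.le_self_pow two_ne_zero _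
    have hb2 : b n ^ 2 ≤ b n ^ 2 * a n := Nat.le_mul_of_pos_right _ ha
    have ha2 : a n ≤ b n ^ 2 * a n := Nat.le_mul_of_pos_left _ (by positivity)
    simp only [mem_product, mem_Icc, squarefreeUpTo, mem_filter]
    exact ⟨⟨hb, by omega⟩, ⟨ha, by omega⟩, hsq n⟩
  · intro m _ n _ hmn
    simp only [Prod.mk.injEq] at hmn
    rw [← hab m, ← hab n, hmn.1, hmn.2]
  · intro n hn
    rw [div_mul_div_comm, one_mul]
    have := hab n
    rw [← this]
    push_cast
    simp [this]

theorem exists_gcd_decomposition (h u v : ℕ) (hu : Squarefree u) (hv : Squarefree v) :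
    ∃ d e a b : ℕ, u = d * a ∧ v = d * (e * b) ∧ a.Coprime (e * b) ∧ b.Coprime h ∧ e ∣ h := by
  obtain ⟨d, a, w, hd, haw, rfl, rfl⟩ : ∃ d a w, 0 < d ∧ Nat.Coprime a w ∧ u = d * a ∧ v = d * w := by
    have hg : 0 < Nat.gcd u v := Nat.gcd_pos_of_pos_left _ (Nat.pos_of_ne_zero hu.ne_zero)
    exact ⟨_, _, _, hg, Nat.coprime_div_gcd_div_gcd hg, (Nat.mul_div_cancel' (Nat.gcd_dvd_left u v)).symm,
      (Nat.mul_div_cancel' (Nat.gcd_dvd_right u v)).symm⟩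
  have hw : Squarefree w := hv.squarefree_of_dvd (dvd_mul_left _ _)
  obtain ⟨b, hb⟩ := Nat.gcd_dvd_left w h
  refine ⟨d, Nat.gcd w h, a, b, rfl, by rw [← hb], by rwa [← hb], ?_, Nat.gcd_dvd_right _ _⟩
  have hcop : Nat.Coprime (Nat.gcd w h) b := Nat.coprime_of_squarefree_mul (hb ▸ hw)
  have hgb : Nat.gcd b h ∣ b := Nat.gcd_dvd_left _ _
  have hbw : b ∣ w := hb ▸ dvd_mul_left _ _
  exact (hcop.coprime_dvd_right hgb).symm.eq_one_of_dvd
    (Nat.dvd_gcd (hgb.trans hbw) (Nat.gcd_dvd_right _ _))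

/-- Write u = da and v = dw with d = gcd(u, v), then w = eb with e = gcd(w, h). Then 1/(uv) =
(1/d²)(1/e)(1/(ab)), where e ∣ h, l = ab is squarefree and at most M², and b is a divisor of l
coprime to h. Summing over d gives at most 2, over e at most the truncated series, and over (l, b)
at most the sieve denominator. -/
theorem sq_sum_squarefree_le (M : ℕ) :
    (∑ u ∈ squarefreeUpTo M, (1 : ℝ) / u) ^ 2 ≤
      2 * (truncSeries M h * selbergSum (pairSieve N (M ^ 2) hh) (M ^ 2)) := by
  -- The number of admissible b for each l is at most `rootCount (pairPoly h) l`, and `selbergTerms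
  -- l` is at least ν(l) because every factor 1/(1 - ν(p)) is at least 1.
  set s := pairSieve N (M ^ 2) hh
  have hG : ∑ l ∈ sieveDivisors s (M ^ 2), ∑ _v ∈ l.divisors.filter (Nat.Coprime · h),
      (1 : ℝ) / l ≤ selbergSum s (M ^ 2) := by
    refine sum_le_sum fun l hl => ?_
    have hlP := dvd_of_mem_sieveDivisors s hl
    have hsq := BoundingSieve.squarefree_of_dvd_prodPrimes hlP
    rw [sum_const, nsmul_eq_mul, mul_one_div]
    calc _ ≤ (rootCount (pairPoly h) l : ℝ) / l := by
          gcongr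
          exact card_coprime_divisors_le_rootCount h hsq
      _ = s.nu l := (nu_pairSieve hh hsq).symm
      _ ≤ _ := by
          rw [BoundingSieve.selbergTerms_apply]
          refine le_mul_of_one_le_right (BoundingSieve.nu_pos_of_dvd_prodPrimes hlP).le ?_
          refine prod_induction _ (1 ≤ ·) (fun _ _ => one_le_mul_of_one_le_of_one_le) le_rfl
            fun p hp => ?_
          have hp' := Nat.prime_of_mem_primeFactors hp
          have hpP := (Nat.dvd_of_mem_primeFactors hp).trans hlP
          have h0 := s.nu_pos_of_prime p hp' hpP
          have h1 := s.nu_lt_one_of_prime p hp' hpP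
          exact (one_le_inv₀ (by linarith)).2 (by linarith)
  have hS := truncSeries_nonneg M h
  refine le_trans ?_ (mul_le_mul (sum_inv_sq_le_two M)
    (mul_le_mul_of_nonneg_left hG hS) (mul_nonneg hS (sum_nonneg fun _ _ =>
      sum_nonneg fun _ _ => by positivity)) zero_le_two)
  rw [sq, sum_mul_sum, ← sum_product', truncSeries, sum_sigma', sum_mul_sum, ← sum_product',
    sum_mul_sum, ← sum_product']
  choose! d e a b hu hv hab hbh heh using exists_gcd_decomposition h
  have hmem : ∀ q : ℕ × ℕ, q ∈ squarefreeUpTo M ×ˢ squarefreeUpTo M →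
      (1 ≤ q.1 ∧ q.1 ≤ M) ∧ (1 ≤ q.2 ∧ q.2 ≤ M) ∧ Squarefree q.1 ∧ Squarefree q.2 := by
    intro q hq
    simp only [squarefreeUpTo, mem_product, mem_filter, mem_Icc] at hq
    tauto
  refine sum_le_sum_of_injOn
    (fun q : ℕ × ℕ => (d q.1 q.2, e q.1 q.2,
      (⟨a q.1 q.2 * b q.1 q.2, b q.1 q.2⟩ : (_ : ℕ) × ℕ)))
    (fun _ _ => by positivity) ?_ ?_ ?_
  · rintro ⟨u, v⟩ hq
    obtain ⟨⟨hu1, huM⟩, ⟨hv1, hvM⟩, hus, hvs⟩ := hmem _ hq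
    dsimp only at *
    replace hu := hu u v hus hvs
    replace hv := hv u v hus hvs
    replace hab := hab u v hus hvs
    replace hbh := hbh u v hus hvs
    replace heh := heh u v hus hvs
    generalize d u v = d at *
    generalize e u v = e at *
    generalize a u v = a at *
    generalize b u v = b at *
    have hdu : d ∣ u := hu ▸ dvd_mul_right _ _
    have hau : a ∣ u := hu ▸ dvd_mul_left _ _
    have hebv : e * b ∣ v := hv ▸ dvd_mul_left _ _
    have hev : e ∣ v := (dvd_mul_right _ _).trans hebv
    have hbv : b ∣ v := (dvd_mul_left _ _).trans hebv
    have hsq : Squarefree (a * b) := (Nat.squarefree_mul (hab.coprime_dvd_right (dvd_mul_left _ _))).2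
      ⟨hus.squarefree_of_dvd hau, hvs.squarefree_of_dvd hbv⟩
    have habM : a * b ≤ M ^ 2 := by
      rw [sq]
      exact Nat.mul_le_mul ((Nat.le_of_dvd hu1 hau).trans huM) ((Nat.le_of_dvd hv1 hbv).trans hvM)
    simp only [mem_product, mem_sigma, mem_filter, mem_Icc, squarefreeUpTo, sieveDivisors,
      Nat.mem_divisors]
    refine ⟨⟨Nat.pos_of_dvd_of_pos hdu hu1, (Nat.le_of_dvd hu1 hdu).trans huM⟩,
      ⟨⟨⟨Nat.pos_of_dvd_of_pos hev hv1, (Nat.le_of_dvd hv1 hev).trans hvM⟩,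
        hvs.squarefree_of_dvd hev⟩, heh⟩, ⟨⟨?_, BoundingSieve.prodPrimes_ne_zero⟩, habM⟩,
      ⟨dvd_mul_left _ _, hsq.ne_zero⟩, hbh⟩
    exact hsq.dvd_primorial.trans (primorial_dvd_primorial habM)
  · rintro ⟨u, v⟩ hq ⟨u', v'⟩ hq' heq
    obtain ⟨⟨hu1, -⟩, ⟨hv1, -⟩, hus, hvs⟩ := hmem _ hq
    obtain ⟨-, -, hus', hvs'⟩ := hmem _ hq'
    simp only [Prod.mk.injEq, Sigma.mk.injEq, heq_eq_eq] at heq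
    obtain ⟨h1, h2, h3, h4⟩ := heq
    -- Since b ≠ 0, a is recovered from ab and b, hence u and v as well.
    have hb0 : 0 < b u v := by
      refine Nat.pos_of_ne_zero fun h0 => ?_
      have := hv u v hus hvs
      rw [h0] at this
      dsimp only at hv1
      omega
    have h5 : a u v = a u' v' := by
      rw [← h4] at h3
      exact Nat.eq_of_mul_eq_mul_right hb0 h3
    refine Prod.ext ((hu u v hus hvs).trans ?_) ((hv u v hus hvs).trans ?_)
    · rw [h1, h5]; exact (hu u' v' hus' hvs').symm
    · rw [h1, h2, h4]; exact (hv u' v' hus' hvs').symm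
  · rintro ⟨u, v⟩ hq
    obtain ⟨-, -, hus, hvs⟩ := hmem _ hq
    apply le_of_eq
    have h1 : (u : ℝ) = d u v * a u v := by exact_mod_cast hu u v hus hvs
    have h2 : (v : ℝ) = d u v * (e u v * b u v) := by exact_mod_cast hv u v hus hvs
    dsimp only
    rw [div_mul_div_comm, div_mul_div_comm, div_mul_div_comm, h1, h2]
    push_cast
    congr 1
    · ring
    · ring

/-- The Selberg sieve bound for prime pairs, in terms of the truncated singular series. -/
theorem primePairs_le {M : ℕ} (hM : 2 ≤ M) (N : ℕ) {h : ℕ} (hh0 : 0 < h) :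
    (primePairs N h : ℝ) ≤
      8 * N * truncSeries M h / Real.log M ^ 2 + 2 * (M : ℝ) ^ 16 := by
  have hS := one_le_truncSeries (show 1 ≤ M by omega) h
  have hM1 : (1 : ℝ) ≤ M := by exact_mod_cast (show 1 ≤ M by omega)
  have hlog : 0 < Real.log M := Real.log_pos (by exact_mod_cast (show 1 < M by omega))
  by_cases hh : Even h
  · have h1 := primePairs_le_selberg (N := N) (R := M ^ 2) hh (Nat.one_le_pow _ _ (by omega))
    have h2 := sq_sum_squarefree_le (N := N) hh M
    have h3 := log_le_two_mul_sum_squarefree M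
    have hG := selbergSum_pos (pairSieve N (M ^ 2) hh) (Nat.one_le_pow 2 M (by omega))
    set G := selbergSum (pairSieve N (M ^ 2) hh) (M ^ 2)
    have h4 : Real.log M ^ 2 ≤ 8 * (truncSeries M h * G) := by
      calc Real.log M ^ 2 ≤ (2 * ∑ u ∈ squarefreeUpTo M, (1 : ℝ) / u) ^ 2 := by gcongr
        _ = 4 * (∑ u ∈ squarefreeUpTo M, (1 : ℝ) / u) ^ 2 := by ring
        _ ≤ _ := by linarith
    have h5 : (N : ℝ) / G ≤ 8 * N * truncSeries M h / Real.log M ^ 2 := by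
      rw [div_le_div_iff₀ hG (by positivity)]
      calc (N : ℝ) * Real.log M ^ 2 ≤ N * (8 * (truncSeries M h * G)) := by gcongr
        _ = _ := by ring
    have h6 : ((M ^ 2 : ℕ) : ℝ) ^ 8 = (M : ℝ) ^ 16 := by push_cast; ring
    have h7 : ((M ^ 2 : ℕ) : ℝ) ≤ (M : ℝ) ^ 16 := by
      push_cast; exact pow_le_pow_right₀ hM1 (by norm_num)
    linarith
  -- For odd h one of n, n + h is even, which forces n = 2.
  · have h1 : primePairs N h ≤ 1 := by
      have hsub : (Ioc 0 N).filter (fun n => n.Prime ∧ (n + h).Prime) ⊆ {2} := by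
        intro n hn
        obtain ⟨-, hn1, hn2⟩ := mem_filter.1 hn
        rw [mem_singleton]
        rcases hn1.eq_two_or_odd' with h2 | h2
        · exact h2
        · exfalso
          have h3 : Even (n + h) := h2.add_odd (Nat.not_even_iff_odd.1 hh)
          have h4 := hn2.even_iff.1 h3
          have := hn1.two_le
          omega
      exact card_le_card hsub
    have h2 : (primePairs N h : ℝ) ≤ 1 := by exact_mod_cast h1
    have h3 : (1 : ℝ) ≤ (M : ℝ) ^ 16 := one_le_pow₀ hM1
    have h4 : 0 ≤ 8 * N * truncSeries M h / Real.log M ^ 2 := by positivity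
    linarith

end PrimePairs

/-! ### The singular series on average over differences of k-th powers -/

section SingularSeriesAverage

open Finset Polynomial

/-- The sum is part of the expansion of ∏ (1 + k/p²) over p ≤ M, and 1 + y ≤ exp y bounds this by
exp(k ∑ 1/p²). -/
theorem sum_squarefree_pow_card_primeFactors_le (k M : ℕ) :
    ∑ d ∈ squarefreeUpTo M, (k : ℝ) ^ #d.primeFactors / (d : ℝ) ^ 2 ≤ Real.exp (2 * k) := by
  calc ∑ d ∈ squarefreeUpTo M, (k : ℝ) ^ #d.primeFactors / (d : ℝ) ^ 2
      ≤ ∑ t ∈ (Nat.primesLE M).powerset, ∏ p ∈ t, (k : ℝ) / (p : ℝ) ^ 2 := by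
        refine sum_le_sum_of_injOn Nat.primeFactors
          (fun _ _ => prod_nonneg fun _ _ => by positivity) ?_ ?_ ?_
        · intro d hd
          simp only [squarefreeUpTo, mem_filter, mem_Icc] at hd
          refine mem_powerset.2 fun p hp => Nat.mem_primesLE.2
            ⟨(Nat.le_of_mem_primeFactors hp).trans hd.1.2, Nat.prime_of_mem_primeFactors hp⟩
        · intro d hd d' hd' h
          rw [← Nat.prod_primeFactors_of_squarefree (mem_filter.1 hd).2,
            ← Nat.prod_primeFactors_of_squarefree (mem_filter.1 hd').2, h]
        · intro d hd
          rw [prod_div_distrib, prod_const, prod_pow, ← Nat.cast_prod,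
            Nat.prod_primeFactors_of_squarefree (mem_filter.1 hd).2]
    _ = ∏ p ∈ Nat.primesLE M, (1 + (k : ℝ) / (p : ℝ) ^ 2) := (prod_one_add _).symm
    _ ≤ ∏ p ∈ Nat.primesLE M, Real.exp ((k : ℝ) / (p : ℝ) ^ 2) :=
        prod_le_prod (fun _ _ => by positivity) fun p _ => by
          rw [add_comm]; exact Real.add_one_le_exp _
    _ = Real.exp (∑ p ∈ Nat.primesLE M, (k : ℝ) / (p : ℝ) ^ 2) := (Real.exp_sum _ _).symm
    _ ≤ Real.exp (2 * k) := by
        gcongr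
        calc ∑ p ∈ Nat.primesLE M, (k : ℝ) / (p : ℝ) ^ 2
            ≤ ∑ p ∈ Icc 1 M, (k : ℝ) / (p : ℝ) ^ 2 := by
              refine sum_le_sum_of_subset_of_nonneg (fun p hp => ?_) fun _ _ _ => by positivity
              rw [Nat.mem_primesLE] at hp
              exact mem_Icc.2 ⟨hp.2.one_le, hp.1⟩
          _ = k * ∑ p ∈ Icc 1 M, (1 : ℝ) / (p : ℝ) ^ 2 := by
              rw [mul_sum]; simp only [mul_one_div]
          _ ≤ k * 2 := by gcongr; exact sum_inv_sq_le_two M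
          _ = _ := by ring

theorem rootCount_X_pow_sub_C_le_pow {k : ℕ} (hk : 0 < k) (c : ℤ) {d : ℕ} (hd : Squarefree d) :
    rootCount (X ^ k - C c) d ≤ k ^ #d.primeFactors := by
  rw [rootCount_eq_prod _ hd]
  exact prod_le_pow_card _ _ _ fun p hp =>
    rootCount_X_pow_sub_C_le hk c (Nat.prime_of_mem_primeFactors hp)

/-- Pairs `i < j` of positive integers up to `J`. -/
def increasingPairs (J : ℕ) : Finset (ℕ × ℕ) := {q ∈ Ioc 0 J ×ˢ Ioc 0 J | q.1 < q.2}

/-- For each i, j is a root of X^k - i^k mod d, which leaves at most k^ω(d) classes. As d ≤ J, the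
rounding error of each class is at most J/d, whence the factor 2. -/
theorem card_increasingPairs_dvd_le {k : ℕ} (hk : 0 < k) {J d : ℕ} (hd : Squarefree d)
    (hdJ : d ≤ J) :
    (#{q ∈ increasingPairs J | d ∣ q.2 ^ k - q.1 ^ k} : ℝ) ≤
      2 * (J : ℝ) ^ 2 * ((k : ℝ) ^ #d.primeFactors / d) := by
  have hd0 : 0 < d := Nat.pos_of_ne_zero hd.ne_zero
  have hsub : {q ∈ increasingPairs J | d ∣ q.2 ^ k - q.1 ^ k} ⊆
      (Ioc 0 J).biUnion fun i => ((Ioc 0 J).filter fun n : ℕ =>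
        (d : ℤ) ∣ (X ^ k - C ((i : ℤ) ^ k) : ℤ[X]).eval (n : ℤ)).image fun n => (i, n) := by
    rintro ⟨i, j⟩ hq
    simp only [increasingPairs, mem_filter, mem_product] at hq
    obtain ⟨⟨⟨hi, hj⟩, hij⟩, hdvd⟩ := hq
    refine mem_biUnion.2 ⟨i, hi, mem_image.2 ⟨j, mem_filter.2 ⟨hj, ?_⟩, rfl⟩⟩
    have h1 := Int.natCast_dvd_natCast.2 hdvd
    rw [Nat.cast_sub (Nat.pow_le_pow_left hij.le k)] at h1
    simpa using h1
  have hbound : ∀ i ∈ Ioc 0 J, (#(((Ioc 0 J).filter fun n : ℕ =>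
        (d : ℤ) ∣ (X ^ k - C ((i : ℤ) ^ k) : ℤ[X]).eval (n : ℤ)).image fun n => (i, n)) : ℝ) ≤
      2 * J * ((k : ℝ) ^ #d.primeFactors / d) := by
    intro i _
    have h1 := (abs_le.1 (abs_card_dvd_eval_sub_le (X ^ k - C ((i : ℤ) ^ k)) J hd0)).2
    have h2 : (rootCount (X ^ k - C ((i : ℤ) ^ k)) d : ℝ) ≤ (k : ℝ) ^ #d.primeFactors := by
      exact_mod_cast rootCount_X_pow_sub_C_le_pow hk _ hd
    set ρ := (rootCount (X ^ k - C ((i : ℤ) ^ k)) d : ℝ)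
    have h3 : (1 : ℝ) ≤ J / d := by
      rw [one_le_div (by exact_mod_cast hd0)]; exact_mod_cast hdJ
    have h4 : (0 : ℝ) ≤ ρ := Nat.cast_nonneg _
    calc _ ≤ ρ / d * J + ρ := by
          refine (Nat.cast_le.2 card_image_le).trans ?_
          linarith
      _ = ρ * (J / d) + ρ * 1 := by ring
      _ ≤ ρ * (J / d) + ρ * (J / d) := by gcongr
      _ = 2 * (ρ * (J / d)) := by ring
      _ ≤ 2 * ((k : ℝ) ^ #d.primeFactors * (J / d)) := by gcongr
      _ = _ := by ring
  calc _ ≤ ((#((Ioc 0 J).biUnion fun i => ((Ioc 0 J).filter fun n : ℕ =>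
        (d : ℤ) ∣ (X ^ k - C ((i : ℤ) ^ k) : ℤ[X]).eval (n : ℤ)).image fun n => (i, n)) : ℕ) : ℝ) := by
        exact_mod_cast card_le_card hsub
    _ ≤ ∑ i ∈ Ioc 0 J, (#(((Ioc 0 J).filter fun n : ℕ =>
        (d : ℤ) ∣ (X ^ k - C ((i : ℤ) ^ k) : ℤ[X]).eval (n : ℤ)).image fun n => (i, n)) : ℝ) := by
        exact_mod_cast card_biUnion_le
    _ ≤ ∑ i ∈ Ioc 0 J, 2 * J * ((k : ℝ) ^ #d.primeFactors / d) := sum_le_sum hbound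
    _ = _ := by
        rw [sum_const, Nat.card_Ioc, nsmul_eq_mul, Nat.sub_zero]; ring

/-- The truncated singular series is bounded on average over differences of `k`-th powers. -/
theorem sum_truncSeries_le {k : ℕ} (hk : 0 < k) {M J : ℕ} (hMJ : M ≤ J) :
    ∑ q ∈ increasingPairs J, truncSeries M (q.2 ^ k - q.1 ^ k) ≤
      2 * Real.exp (2 * k) * (J : ℝ) ^ 2 := by
  calc ∑ q ∈ increasingPairs J, truncSeries M (q.2 ^ k - q.1 ^ k)
      = ∑ d ∈ squarefreeUpTo M, ∑ q ∈ increasingPairs J,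
          if d ∣ q.2 ^ k - q.1 ^ k then (1 : ℝ) / d else 0 := by
        simp only [truncSeries, sum_filter]
        exact sum_comm
    _ = ∑ d ∈ squarefreeUpTo M,
          #{q ∈ increasingPairs J | d ∣ q.2 ^ k - q.1 ^ k} * ((1 : ℝ) / d) := by
        refine sum_congr rfl fun d _ => ?_
        rw [← sum_filter, sum_const, nsmul_eq_mul]
    _ ≤ ∑ d ∈ squarefreeUpTo M,
          2 * (J : ℝ) ^ 2 * ((k : ℝ) ^ #d.primeFactors / d) * ((1 : ℝ) / d) := by
        refine sum_le_sum fun d hd => ?_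
        simp only [squarefreeUpTo, mem_filter, mem_Icc] at hd
        gcongr
        exact card_increasingPairs_dvd_le hk hd.2 (hd.1.2.trans hMJ)
    _ = 2 * (J : ℝ) ^ 2 * ∑ d ∈ squarefreeUpTo M, (k : ℝ) ^ #d.primeFactors / (d : ℝ) ^ 2 := by
        rw [mul_sum]
        refine sum_congr rfl fun d _ => ?_
        rw [mul_assoc, div_mul_div_comm, mul_one, sq (d : ℝ)]
    _ ≤ 2 * (J : ℝ) ^ 2 * Real.exp (2 * k) := by
        gcongr
        exact sum_squarefree_pow_card_primeFactors_le k M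
    _ = _ := by ring

end SingularSeriesAverage

/-! ### First and second moments of the number of representations -/

section SecondMoment

open Finset

/-- The number of representations `n = p + j ^ k` with `p ≤ P` prime and `0 < j ≤ J`. -/
def boundedReps (k P J n : ℕ) : ℕ := #{q ∈ Nat.primesLE P ×ˢ Ioc 0 J | q.1 + q.2 ^ k = n}

theorem finite_primePowReps {k : ℕ} (hk : 0 < k) (n : ℕ) :
    {q : ℕ × ℕ | q.1.Prime ∧ 1 ≤ q.2 ∧ q.1 + q.2 ^ k = n}.Finite := by
  refine ((range (n + 1)) ×ˢ (range (n + 1))).finite_toSet.subset ?_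
  rintro ⟨p, j⟩ ⟨-, -, h⟩
  have : j ≤ j ^ k := Nat.le_self_pow hk.ne' j
  dsimp only at h
  simp only [coe_product, coe_range, Set.mem_prod, Set.mem_Iio]
  omega

theorem boundedReps_le_primePowReps {k : ℕ} (hk : 0 < k) (P J n : ℕ) :
    boundedReps k P J n ≤ primePowReps k n := by
  rw [boundedReps, primePowReps, ← Set.ncard_coe_finset]
  refine Set.ncard_le_ncard ?_ (finite_primePowReps hk n)
  rintro ⟨p, j⟩ h
  simp only [mem_coe, mem_filter, mem_product, Nat.mem_primesLE, mem_Ioc] at h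
  exact ⟨h.1.1.2, h.1.2.1, h.2⟩

theorem add_pow_mem_Ioc {k P J N : ℕ} (hN : P + J ^ k ≤ N) {q : ℕ × ℕ}
    (hq : q ∈ Nat.primesLE P ×ˢ Ioc 0 J) : q.1 + q.2 ^ k ∈ Ioc 0 N := by
  simp only [mem_product, Nat.mem_primesLE, mem_Ioc] at hq ⊢
  have h1 := Nat.pow_le_pow_left hq.2.2 k
  have h2 := hq.1.2.pos
  omega

theorem sum_boundedReps {k P J N : ℕ} (hN : P + J ^ k ≤ N) :
    ∑ n ∈ Ioc 0 N, boundedReps k P J n = Nat.primeCounting P * J := by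
  have := card_eq_sum_card_fiberwise (s := Nat.primesLE P ×ˢ Ioc 0 J) (t := Ioc 0 N)
    (f := fun q : ℕ × ℕ => q.1 + q.2 ^ k) (fun q hq => add_pow_mem_Ioc hN hq)
  rw [card_product, Nat.primesLE_card_eq_primeCounting, Nat.card_Ioc, Nat.sub_zero] at this
  exact this.symm

/-- A collision is determined by i, j and the smaller prime q, because p = q + (j^k - i^k). -/
theorem card_collisions_lt_le (k : ℕ) {P J N : ℕ} (hPN : P ≤ N) :
    #{z ∈ (Nat.primesLE P ×ˢ Ioc 0 J) ×ˢ (Nat.primesLE P ×ˢ Ioc 0 J) |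
      z.1.1 + z.1.2 ^ k = z.2.1 + z.2.2 ^ k ∧ z.1.2 < z.2.2} ≤
    ∑ q ∈ increasingPairs J, primePairs N (q.2 ^ k - q.1 ^ k) := by
  simp only [primePairs]
  rw [← card_sigma]
  refine card_le_card_of_injOn
    (fun z => (⟨(z.1.2, z.2.2), z.2.1⟩ : (_ : ℕ × ℕ) × ℕ)) ?_ ?_
  · rintro ⟨⟨p, i⟩, q, j⟩ hz
    simp only [coe_filter, mem_product, Nat.mem_primesLE, mem_Ioc, Set.mem_ofPred_eq] at hz
    obtain ⟨⟨⟨⟨hpP, hp⟩, hi⟩, ⟨hqP, hq⟩, hj⟩, heq, hij⟩ := hz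
    have h1 := Nat.pow_le_pow_left hij.le k
    have h2 : q + (j ^ k - i ^ k) = p := by omega
    simp only [coe_sigma, Set.mem_sigma_iff, mem_coe, increasingPairs, mem_filter, mem_product,
      mem_Ioc, h2]
    exact ⟨⟨⟨hi, hj⟩, hij⟩, ⟨hq.pos, hqP.trans hPN⟩, hq, hp⟩
  · rintro ⟨⟨p, i⟩, q, j⟩ hz ⟨⟨p', i'⟩, q', j'⟩ hz' h
    simp only [coe_filter, Set.mem_ofPred_eq] at hz hz'
    simp only [Sigma.mk.injEq, Prod.mk.injEq, heq_eq_eq] at h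
    obtain ⟨⟨rfl, rfl⟩, rfl⟩ := h
    have h1 := hz.2.1
    have h2 := hz'.2.1
    have h3 : p = p' := by omega
    rw [h3]

/-- The sum of squares counts ordered pairs of representations of the same n. Equal j force equal p,
giving the diagonal, and the cases i < j and i > j are exchanged by symmetry. -/
theorem sum_boundedReps_sq_le (k : ℕ) {P J N : ℕ} (hPN : P ≤ N) :
    ∑ n ∈ Ioc 0 N, boundedReps k P J n ^ 2 ≤
      P * J + 2 * ∑ q ∈ increasingPairs J, primePairs N (q.2 ^ k - q.1 ^ k) := by
  set Q := Nat.primesLE P ×ˢ Ioc 0 J with hQ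
  set A := (Q ×ˢ Q).filter fun z => z.1.1 + z.1.2 ^ k = z.2.1 + z.2.2 ^ k ∧ z.1.2 < z.2.2
  have h1 : ∑ n ∈ Ioc 0 N, boundedReps k P J n ^ 2 ≤
      #((Q ×ˢ Q).filter fun z => z.1.1 + z.1.2 ^ k = z.2.1 + z.2.2 ^ k) := by
    simp only [boundedReps, sq, ← card_product]
    rw [← card_sigma]
    refine card_le_card_of_injOn (fun z => z.2) ?_ ?_
    · rintro ⟨n, q, q'⟩ hz
      simp only [coe_sigma, Set.mem_sigma_iff, mem_coe, mem_product, mem_filter] at hz ⊢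
      exact ⟨⟨mem_product.2 hz.2.1.1, mem_product.2 hz.2.2.1⟩, hz.2.1.2.trans hz.2.2.2.symm⟩
    · rintro ⟨n, z⟩ hz ⟨n', z'⟩ hz' h
      simp only [coe_sigma, Set.mem_sigma_iff, mem_coe, mem_product, mem_filter] at hz hz'
      dsimp only at h
      subst h
      rw [← hz.2.1.2, ← hz'.2.1.2]
  have h2 : (Q ×ˢ Q).filter (fun z => z.1.1 + z.1.2 ^ k = z.2.1 + z.2.2 ^ k) ⊆
      Q.image (fun q => (q, q)) ∪ (A ∪ A.image Prod.swap) := by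
    rintro ⟨⟨p, i⟩, q, j⟩ hz
    rw [mem_filter, mem_product] at hz
    obtain ⟨⟨hz1, hz2⟩, heq⟩ := hz
    dsimp only at heq
    rw [mem_union, mem_union]
    rcases lt_trichotomy i j with h | h | h
    · exact Or.inr (Or.inl (mem_filter.2 ⟨mem_product.2 ⟨hz1, hz2⟩, heq, h⟩))
    · subst h
      have : p = q := by omega
      subst this
      exact Or.inl (mem_image.2 ⟨_, hz1, rfl⟩)
    · exact Or.inr (Or.inr (mem_image.2 ⟨((q, j), (p, i)),
        mem_filter.2 ⟨mem_product.2 ⟨hz2, hz1⟩, heq.symm, h⟩, rfl⟩))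
  have h3 := card_collisions_lt_le k (J := J) hPN
  have h4 : #Q ≤ P * J := by
    rw [hQ, card_product, Nat.card_Ioc, Nat.sub_zero]
    refine Nat.mul_le_mul_right _ ?_
    calc #(Nat.primesLE P) ≤ #(Ioc 0 P) := card_le_card fun p hp => by
          rw [Nat.mem_primesLE] at hp
          exact mem_Ioc.2 ⟨hp.2.pos, hp.1⟩
      _ = P := by simp
  have h5 := (card_le_card h2).trans ((card_union_le _ _).trans (add_le_add_right (card_union_le _ _) _))
  have h6 : #(Q.image fun q => (q, q)) ≤ #Q := card_image_le
  have h7 : #(A.image Prod.swap) ≤ #A := card_image_le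
  change #A ≤ _ at h3
  omega

theorem sum_boundedReps_sq_le_real {k : ℕ} (hk : 0 < k) {P J N M : ℕ} (hPN : P ≤ N) (hM : 2 ≤ M)
    (hMJ : M ≤ J) :
    ∑ n ∈ Ioc 0 N, (boundedReps k P J n : ℝ) ^ 2 ≤
      N * J + 32 * Real.exp (2 * k) * N * (J : ℝ) ^ 2 / Real.log M ^ 2 +
        4 * (J : ℝ) ^ 2 * (M : ℝ) ^ 16 := by
  have h1 : ∑ n ∈ Ioc 0 N, (boundedReps k P J n : ℝ) ^ 2 ≤
      P * J + 2 * ∑ q ∈ increasingPairs J, (primePairs N (q.2 ^ k - q.1 ^ k) : ℝ) := by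
    exact_mod_cast sum_boundedReps_sq_le k (J := J) hPN
  have h2 : ∑ q ∈ increasingPairs J, (primePairs N (q.2 ^ k - q.1 ^ k) : ℝ) ≤
      ∑ q ∈ increasingPairs J, (8 * N / Real.log M ^ 2 * truncSeries M (q.2 ^ k - q.1 ^ k) +
        2 * (M : ℝ) ^ 16) := by
    refine sum_le_sum fun q hq => ?_
    have hq' : q.1 < q.2 := (mem_filter.1 hq).2
    refine (primePairs_le hM N (Nat.sub_pos_of_lt (Nat.pow_lt_pow_left hq' hk.ne'))).trans ?_
    apply le_of_eq; ring
  have h3 : (#(increasingPairs J) : ℝ) ≤ (J : ℝ) ^ 2 := by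
    have : #(increasingPairs J) ≤ J * J := by
      refine (card_filter_le _ _).trans ?_
      simp
    rw [sq]; exact_mod_cast this
  rw [sum_add_distrib, ← mul_sum, sum_const, nsmul_eq_mul] at h2
  have h4 : 8 * N / Real.log M ^ 2 * ∑ q ∈ increasingPairs J, truncSeries M (q.2 ^ k - q.1 ^ k) ≤
      8 * N / Real.log M ^ 2 * (2 * Real.exp (2 * k) * (J : ℝ) ^ 2) := by
    gcongr
    exact sum_truncSeries_le hk hMJ
  have h5 : (#(increasingPairs J) : ℝ) * (2 * (M : ℝ) ^ 16) ≤ (J : ℝ) ^ 2 * (2 * (M : ℝ) ^ 16) := by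
    gcongr
  have h6 : (P : ℝ) * J ≤ N * J := by gcongr
  have h7 : 32 * Real.exp (2 * k) * N * (J : ℝ) ^ 2 / Real.log M ^ 2 =
      2 * (8 * N / Real.log M ^ 2 * (2 * Real.exp (2 * k) * (J : ℝ) ^ 2)) := by ring
  linarith

/-- A Paley–Zygmund inequality for finite sums. -/
theorem sq_le_card_filter_mul {s : Finset ℕ} {f : ℕ → ℝ} {T W V : ℝ}
    (hW0 : 0 ≤ W) (hW : W ≤ ∑ n ∈ s, f n) (hV : ∑ n ∈ s, f n ^ 2 ≤ V) (hT : #s * T ≤ W / 2)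
    (hT0 : 0 ≤ T) : W ^ 2 / 4 ≤ #(s.filter fun n => T ≤ f n) * V := by
  have h1 : ∑ n ∈ s with ¬ T ≤ f n, f n ≤ #s * T := by
    calc _ ≤ ∑ n ∈ s with ¬ T ≤ f n, T :=
          sum_le_sum fun n hn => (not_le.1 (mem_filter.1 hn).2).le
      _ = #(s.filter fun n => ¬ T ≤ f n) * T := by rw [sum_const, nsmul_eq_mul]
      _ ≤ _ := by gcongr; exact filter_subset _ _
  have h2 := sum_filter_add_sum_filter_not s (fun n => T ≤ f n) f
  have h3 : W / 2 ≤ ∑ n ∈ s with T ≤ f n, f n := by linarith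
  have h4 : ∑ n ∈ s with T ≤ f n, f n ^ 2 ≤ V :=
    (sum_le_sum_of_subset_of_nonneg (filter_subset _ _) fun _ _ _ => sq_nonneg _).trans hV
  calc W ^ 2 / 4 = (W / 2) ^ 2 := by ring
    _ ≤ (∑ n ∈ s with T ≤ f n, f n) ^ 2 := by gcongr
    _ ≤ #(s.filter fun n => T ≤ f n) * ∑ n ∈ s with T ≤ f n, f n ^ 2 := sq_sum_le_card_mul_sum_sq
    _ ≤ _ := by gcongr

end SecondMoment

/-! ### Choice of parameters for large x -/

section PositiveProportion

open Finset Filter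

theorem eventually_log_sq_le_rpow {a b : ℝ} (ha : 0 < a) (hb : 0 < b) :
    ∀ᶠ x : ℝ in atTop, Real.log x ^ 2 ≤ b * x ^ a := by
  have h := (isLittleO_log_rpow_rpow_atTop (2 : ℝ) ha).bound hb
  filter_upwards [h, eventually_ge_atTop 1] with x hx hx1
  have h0 := Real.log_nonneg hx1
  rw [Real.norm_of_nonneg (by positivity), Real.norm_of_nonneg (by positivity)] at hx
  simpa using hx

theorem eventually_primeCounting_half_ge :
    ∀ᶠ x : ℝ in atTop, x / (8 * Real.log x) ≤ Nat.primeCounting ⌊x / 2⌋₊ := by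
  have h := (Real.isLittleO_log_id_atTop).bound (show (0 : ℝ) < 1 / 16 by norm_num)
  filter_upwards [h, eventually_ge_atTop 100] with x hx hx100
  have hlogx : 0 < Real.log x := Real.log_pos (by linarith)
  simp only [id] at hx
  rw [Real.norm_of_nonneg hlogx.le, Real.norm_of_nonneg (by linarith)] at hx
  have h1 := Chebyshev.pi_ge' (x := x / 2) (by linarith)
  have h2 : Real.log (x / 2 + 2) ≤ Real.log x := Real.log_le_log (by linarith) (by linarith)
  have h3 : Real.log (x / 2) ≤ Real.log x := Real.log_le_log (by linarith) (by linarith)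
  have h4 : 0 < Real.log (x / 2) := Real.log_pos (by linarith)
  have h5 := Real.log_two_gt_d9
  have h6 : x / 8 ≤ (x / 2 - 1) * Real.log 2 - Real.log (x / 2 + 2) := by nlinarith
  refine le_trans ?_ h1
  rw [← div_div]
  calc x / 8 / Real.log x ≤ x / 8 / Real.log (x / 2) := by gcongr
    _ ≤ _ := by gcongr

theorem eventually_card_boundedReps_ge {k : ℕ} (hk : 0 < k) :
    ∃ c : ℝ, 0 < c ∧ ∀ᶠ x : ℝ in atTop, c * x ≤
      (#((Ioc 0 ⌊x⌋₊).filter fun n => 1 / 64 * (x ^ ((1 : ℝ) / k) / Real.log x) ≤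
        (boundedReps k ⌊x / 2⌋₊ ⌊(x / 2) ^ ((1 : ℝ) / k)⌋₊ n : ℝ)) : ℝ) := by
  have hkR : (0 : ℝ) < k := by exact_mod_cast hk
  have hk1 : (1 : ℝ) ≤ k := by exact_mod_cast hk
  -- The 5 is 1 for the diagonal and 4 for the sieve remainder. The rest is the sieve main term,
  -- with log M ≥ (log x)/(80k).
  set B : ℝ := 5 + 32 * Real.exp (2 * k) * (80 * k) ^ 2 with hB
  have hB0 : 0 < B := by positivity
  refine ⟨1 / (256 * B), by positivity, ?_⟩
  -- The level t = x^(1/(40k)) makes M^16 ≤ x^(2/5), so that M^16 log² x ≤ x once log² x ≤ x^(3/5).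
  -- The condition t ≥ 4 ensures M ≥ 2 and M ≤ J.
  have ht := tendsto_rpow_atTop (show (0 : ℝ) < 1 / (40 * k) by positivity)
  filter_upwards [eventually_primeCounting_half_ge, ht.eventually_ge_atTop 4,
    eventually_log_sq_le_rpow (a := 1 / k) (b := 1 / 4) (by positivity) (by norm_num),
    eventually_log_sq_le_rpow (a := 3 / 5) (b := 1) (by norm_num) one_pos,
    eventually_ge_atTop 3] with x hπ ht4 hlog1 hlog2 hx3
  have hx0 : (0 : ℝ) < x := by linarith
  have hL : 0 < Real.log x := Real.log_pos (by linarith)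
  set L := Real.log x with hLdef
  set t := x ^ ((1 : ℝ) / (40 * k)) with htdef
  set N := ⌊x⌋₊
  set P := ⌊x / 2⌋₊
  set J := ⌊(x / 2) ^ ((1 : ℝ) / k)⌋₊ with hJ
  set M := ⌊t⌋₊ with hMdef
  have hNx : (N : ℝ) ≤ x := Nat.floor_le hx0.le
  have hPN : P ≤ N := Nat.floor_mono (by linarith)
  have hPJN : P + J ^ k ≤ N := by
    apply Nat.le_floor
    have h1 : (P : ℝ) ≤ x / 2 := Nat.floor_le (by positivity)
    have h2 : (J : ℝ) ^ k ≤ x / 2 := by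
      calc (J : ℝ) ^ k ≤ ((x / 2) ^ ((1 : ℝ) / k)) ^ k := by
            gcongr; exact Nat.floor_le (by positivity)
        _ = x / 2 := by
            rw [← Real.rpow_natCast, ← Real.rpow_mul (by positivity), one_div,
              inv_mul_cancel₀ hkR.ne', Real.rpow_one]
    push_cast
    linarith
  have htk : x ^ ((1 : ℝ) / k) = t ^ 40 := by
    rw [htdef, ← Real.rpow_natCast, ← Real.rpow_mul hx0.le]
    congr 1
    push_cast
    field_simp
  have ht40 : 4 * t ≤ t ^ 40 := by
    calc 4 * t ≤ t * t := by gcongr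
      _ = t ^ 2 := by ring
      _ ≤ t ^ 40 := pow_le_pow_right₀ (by linarith) (by norm_num)
  have hJlow : x ^ ((1 : ℝ) / k) / 4 ≤ J := by
    have h1 : (x / 2) ^ ((1 : ℝ) / k) < J + 1 := Nat.lt_floor_add_one _
    have h2 : x ^ ((1 : ℝ) / k) / 2 ≤ (x / 2) ^ ((1 : ℝ) / k) := by
      rw [Real.div_rpow hx0.le (by norm_num)]
      gcongr
      calc (2 : ℝ) ^ ((1 : ℝ) / k) ≤ 2 ^ (1 : ℝ) :=
            Real.rpow_le_rpow_of_exponent_le (by norm_num) ((div_le_one hkR).2 hk1)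
        _ = 2 := Real.rpow_one _
    rw [htk] at *
    linarith
  have hM2 : 2 ≤ M := Nat.le_floor (by push_cast; linarith)
  have hMt : (M : ℝ) ≤ t := Nat.floor_le (by positivity)
  have hMJ : M ≤ J := by
    have : (M : ℝ) ≤ J := by rw [htk] at hJlow; linarith
    exact_mod_cast this
  have hlogM : L / (80 * k) ≤ Real.log M := by
    have h1 : t < M + 1 := Nat.lt_floor_add_one _
    have h2 : Real.log t = L / (40 * k) := by
      rw [htdef, Real.log_rpow hx0]; ring
    have h3 : t ≤ (M : ℝ) ^ 2 := by nlinarith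
    have h4 := Real.log_le_log (by linarith) h3
    rw [Real.log_pow, h2] at h4
    push_cast at h4
    have h5 : L / (80 * k) = L / (40 * k) / 2 := by rw [div_div]; ring
    linarith
  have hM16 : (M : ℝ) ^ 16 ≤ x / L ^ 2 := by
    rw [le_div_iff₀ (by positivity)]
    calc (M : ℝ) ^ 16 * L ^ 2 ≤ t ^ 16 * (1 * x ^ ((3 : ℝ) / 5)) := by gcongr
      _ ≤ x ^ ((2 : ℝ) / 5) * (1 * x ^ ((3 : ℝ) / 5)) := by
          gcongr
          rw [htdef, ← Real.rpow_natCast, ← Real.rpow_mul hx0.le]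
          apply Real.rpow_le_rpow_of_exponent_le (by linarith)
          rw [one_div, inv_mul_le_iff₀ (by positivity)]
          push_cast
          nlinarith
      _ = x := by
          rw [one_mul, ← Real.rpow_add hx0]; norm_num
  have hJL : L ^ 2 ≤ J := by linarith
  have hJ0 : (0 : ℝ) < J := lt_of_lt_of_le (by positivity) hJL
  have hV : ∑ n ∈ Ioc 0 N, (boundedReps k P J n : ℝ) ^ 2 ≤ B * (x * (J : ℝ) ^ 2 / L ^ 2) := by
    refine (sum_boundedReps_sq_le_real hk hPN hM2 hMJ).trans ?_
    have h1 : (N : ℝ) * J ≤ x * (J : ℝ) ^ 2 / L ^ 2 := by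
      rw [le_div_iff₀ (by positivity)]
      calc (N : ℝ) * J * L ^ 2 ≤ x * J * J := by gcongr
        _ = _ := by ring
    have h2 : 32 * Real.exp (2 * k) * N * (J : ℝ) ^ 2 / Real.log M ^ 2 ≤
        32 * Real.exp (2 * k) * (80 * k) ^ 2 * (x * (J : ℝ) ^ 2 / L ^ 2) := by
      calc _ ≤ 32 * Real.exp (2 * k) * x * (J : ℝ) ^ 2 / (L / (80 * k)) ^ 2 := by gcongr
        _ = _ := by field_simp
    have h3 : 4 * (J : ℝ) ^ 2 * (M : ℝ) ^ 16 ≤ 4 * (x * (J : ℝ) ^ 2 / L ^ 2) := by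
      calc _ ≤ 4 * (J : ℝ) ^ 2 * (x / L ^ 2) := by gcongr
        _ = _ := by ring
    rw [hB]
    linarith
  have hW : x / (8 * L) * J ≤ ∑ n ∈ Ioc 0 N, (boundedReps k P J n : ℝ) := by
    rw [← Nat.cast_sum, sum_boundedReps hPJN]
    push_cast
    gcongr
  -- As x^(1/k) ≤ 4J, the constant 1/64 makes this at most xJ/(16L), exactly half of the lower bound
  -- for the first moment.
  have hT : #(Ioc 0 N) * (1 / 64 * (x ^ ((1 : ℝ) / k) / L)) ≤ x / (8 * L) * J / 2 := by
    rw [Nat.card_Ioc, Nat.sub_zero]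
    calc (N : ℝ) * (1 / 64 * (x ^ ((1 : ℝ) / k) / L))
        ≤ x * (1 / 64 * (4 * J / L)) := by gcongr; linarith
      _ = _ := by field_simp; norm_num
  have key := sq_le_card_filter_mul (by positivity) hW hV hT (by positivity)
  set c := (#((Ioc 0 N).filter fun n => 1 / 64 * (x ^ ((1 : ℝ) / k) / L) ≤
        (boundedReps k P J n : ℝ)) : ℝ)
  have h1 : (x / (8 * L) * J) ^ 2 / 4 = x / 256 * (x * (J : ℝ) ^ 2 / L ^ 2) := by
    field_simp; norm_num
  rw [h1, ← mul_assoc] at key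
  have h2 := le_of_mul_le_mul_right key (by positivity)
  rw [div_mul_eq_mul_div, one_mul, div_le_iff₀ (by positivity)]
  linarith

end PositiveProportion

/-! ### Uniformity in x ≥ 3 -/

theorem corollary2 (k : ℕ) (hk : 2 ≤ k) :
    ∃ c₁ c₂ : ℝ, 0 < c₁ ∧ 0 < c₂ ∧
      (∀ x : ℝ, 3 ≤ x →
        c₂ * x ≤ ({n : ℕ | 1 ≤ n ∧ (n : ℝ) ≤ x ∧
          c₁ * (x ^ ((1 : ℝ) / (k : ℝ)) / Real.log x) ≤ (primePowReps k n : ℝ)}.ncard : ℝ)) ∧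
      (∀ x : ℝ, 3 ≤ x →
        c₂ * x ≤ ({n : ℕ | 1 ≤ n ∧ (n : ℝ) ≤ x ∧
          ∃ p j : ℕ, p.Prime ∧ 1 ≤ j ∧ p + j ^ k = n}.ncard : ℝ)) := by
  have hk0 : 0 < k := by omega
  have hk1 : (1 : ℝ) ≤ k := by exact_mod_cast hk0
  obtain ⟨c, hc, hev⟩ := eventually_card_boundedReps_ge hk0
  obtain ⟨X₁, hX₁⟩ := Filter.eventually_atTop.1 hev
  -- X ≥ 64 makes 1/X at most the constant 1/64 valid for large x. For x ≤ X the threshold is at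
  -- most x/X ≤ 1, as log x ≥ 1, and so is the required count. The single integer 3 = 2 + 1^k then
  -- suffices.
  set X := max X₁ 64
  have hX64 : (64 : ℝ) ≤ X := le_max_right _ _
  have hX0 : (0 : ℝ) < X := by linarith
  have hfin : ∀ (x : ℝ) (Q : ℕ → Prop), {n : ℕ | 1 ≤ n ∧ (n : ℝ) ≤ x ∧ Q n}.Finite := fun x Q =>
    (Finset.Iic ⌊x⌋₊).finite_toSet.subset fun n hn => by
      simpa using Nat.le_floor hn.2.1
  have hfirst : ∀ x : ℝ, 3 ≤ x → min c (1 / X) * x ≤ ({n : ℕ | 1 ≤ n ∧ (n : ℝ) ≤ x ∧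
      1 / X * (x ^ ((1 : ℝ) / (k : ℝ)) / Real.log x) ≤ (primePowReps k n : ℝ)}.ncard : ℝ) := by
    intro x hx
    have hL1 : 1 ≤ Real.log x := by
      rw [Real.le_log_iff_exp_le (by linarith)]
      linarith [Real.exp_one_lt_d9]
    rcases le_total X x with hXx | hXx
    · calc min c (1 / X) * x ≤ c * x := by gcongr; exact min_le_left _ _
        _ ≤ _ := hX₁ x ((le_max_left _ _).trans hXx)
        _ ≤ _ := by
          rw [← Set.ncard_coe_finset]
          refine Nat.cast_le.2 (Set.ncard_le_ncard ?_ (hfin x _))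
          intro n hn
          rw [Finset.mem_coe, Finset.mem_filter, Finset.mem_Ioc] at hn
          refine ⟨hn.1.1, (Nat.le_floor_iff (by linarith)).1 hn.1.2, ?_⟩
          calc 1 / X * (x ^ ((1 : ℝ) / (k : ℝ)) / Real.log x)
              ≤ 1 / 64 * (x ^ ((1 : ℝ) / (k : ℝ)) / Real.log x) := by gcongr
            _ ≤ _ := hn.2
            _ ≤ _ := Nat.cast_le.2 (boundedReps_le_primePowReps hk0 _ _ n)
    · have h3 : (3 : ℕ) ∈ {n : ℕ | 1 ≤ n ∧ (n : ℝ) ≤ x ∧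
          1 / X * (x ^ ((1 : ℝ) / (k : ℝ)) / Real.log x) ≤ (primePowReps k n : ℝ)} := by
        refine ⟨by norm_num, by exact_mod_cast hx, ?_⟩
        have hr : 1 ≤ primePowReps k 3 :=
          (Set.ncard_pos (finite_primePowReps hk0 3)).2
            ⟨(2, 1), Nat.prime_two, le_rfl, by simp⟩
        calc 1 / X * (x ^ ((1 : ℝ) / (k : ℝ)) / Real.log x) ≤ 1 / X * (x / 1) := by
              gcongr
              calc x ^ ((1 : ℝ) / (k : ℝ)) ≤ x ^ (1 : ℝ) :=
                    Real.rpow_le_rpow_of_exponent_le (by linarith)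
                      ((div_le_one (by linarith)).2 hk1)
                _ = x := Real.rpow_one x
          _ = x / X := by ring
          _ ≤ 1 := (div_le_one hX0).2 hXx
          _ ≤ _ := by exact_mod_cast hr
      calc min c (1 / X) * x ≤ 1 / X * x := by gcongr; exact min_le_right _ _
        _ = x / X := by ring
        _ ≤ 1 := (div_le_one hX0).2 hXx
        _ ≤ _ := by exact_mod_cast Nat.succ_le_of_lt ((Set.ncard_pos (hfin x _)).2 ⟨3, h3⟩)
  refine ⟨1 / X, min c (1 / X), by positivity, by positivity, hfirst, fun x hx => ?_⟩
  refine (hfirst x hx).trans (Nat.cast_le.2 (Set.ncard_le_ncard ?_ (hfin x _)))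
  rintro n ⟨hn1, hnx, hn⟩
  refine ⟨hn1, hnx, ?_⟩
  have hlog : 0 < Real.log x := Real.log_pos (by linarith)
  have hx0 : 0 < x := by linarith
  -- The threshold is strictly positive, so every n counted in the first part has a representation.
  have hpos : (0 : ℝ) < primePowReps k n := lt_of_lt_of_le (by positivity) hn
  obtain ⟨⟨p, j⟩, hp, hj, heq⟩ := Set.nonempty_of_ncard_ne_zero
    (show primePowReps k n ≠ 0 by exact_mod_cast hpos.ne')
  exact ⟨p, j, hp, hj, heq⟩
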